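/- All graphs are finite and simple. For a graph \(G\) with ordered vertex set \(1,\dots,2n\), let \(PM(G)=\sum_M\prod_{e\in M}x_e\) be its perfect-matching polynomial, where \(M\) runs over the perfect matchings of \(G\) and there is one variable \(x_e\) for each edge \(e\). For an orientation \(D\) of \(G\), let \(\mathrm{sgn}_D(M)\) be the sign of the permutation \((u_1,v_1,\dots,u_n,v_n)\), where \(u_1v_1,\dots,u_nv_n\) are the edges of \(M\), directed from \(u_i\) to \(v_i\) in \(D\), and let \(\mathrm{Pf}(A_D)=\sum_M \mathrm{sgn}_D(M)\prod_{e\in M}x_e\) be the Pfaffian of the weighted skew-adjacency matrix \(A_D\). (If \(G\) has an odd number of vertices, both polynomials are \(0\).) The Pfaffian number \(\mathrm{pf}(G)\) is the least positive integer \(k\) such that \(PM(G)=\sum_{i=1}^k c_i\,\mathrm{Pf}(A_{D_i})\) for some orientations \(D_1,\dots,D_k\) of \(G\) and some real numbers \(c_1,\dots,c_k\). The orientable genus \(\gamma(G)\) is the least \(g\) such that \(G\) embeds without crossings in the closed orientable surface with \(g\) handles. Put \(\mathrm{pf}_{\max}(g)=\max\{\mathrm{pf}(G):\gamma(G)\le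 g\}\) (as a supremum in \(\mathbb N\cup\{\infty\}\), so that no bound on these numbers is presupposed). **Theorem.** For every \(g\ge 1\), \[ \mathrm{pf}_{\max}(g)\ \ge\ \left(\tfrac83\right)^g . \] A witness is the disjoint union \(K_{3,3}^{\sqcup g}\) of \(g\) copies of \(K_{3,3}\): it satisfies \(\gamma(K_{3,3}^{\sqcup g})\le g\) and \(\mathrm{pf}(K_{3,3}^{\sqcup g})\ge(8/3)^g\). -/

import Mathlib

open scoped ENNReal unitInterval

noncomputable section

namespace SimpleGraph

/-! ### Orientations, perfect matchings, Pfaffians -/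

/-- An orientation of `G`: a choice of exactly one direction for every edge. -/
structure EdgeOrientation {V : Type*} (G : SimpleGraph V) where
  /-- `arc u v` says that `uv` is an edge, directed from `u` to `v`. -/
  arc : V → V → Prop
  adj_iff : ∀ u v, G.Adj u v ↔ arc u v ∨ arc v u
  asymm : ∀ u v, arc u v → ¬ arc v u

/-- The (finite) set `𝓜(G)` of perfect matchings of a finite graph `G`. -/
def perfectMatchings {V : Type*} [Finite V] (G : SimpleGraph V) : Finset G.Subgraph :=
  (Set.toFinite {M : G.Subgraph | M.IsPerfectMatching}).toFinset

/-- The monomial `∏_{e ∈ M} x_e`, with one variable `x_e` for each edge `e` of `G`. -/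
def matchingMonomial {V : Type*} [Finite V] {G : SimpleGraph V} (M : G.Subgraph) :
    MvPolynomial G.edgeSet ℝ :=
  ∏ e ∈ (Set.toFinite {e : G.edgeSet | (e : Sym2 V) ∈ M.edgeSet}).toFinset, MvPolynomial.X e

/-- The perfect-matching polynomial `PM(G)`. -/
def matchingPolynomial {V : Type*} [Finite V] (G : SimpleGraph V) : MvPolynomial G.edgeSet ℝ :=
  ∑ M ∈ G.perfectMatchings, matchingMonomial M

/-- The bijection `l` lists the vertices of `G` as `u₁, v₁, u₂, v₂, …, uₙ, vₙ`, where the `uᵢvᵢ`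
are edges of `M` directed from `uᵢ` to `vᵢ` in `D` (positions are counted from `0`, so `uᵢ` stands
at an even position and `vᵢ` right after it). -/
def EdgeOrientation.IsListing {V : Type*} {G : SimpleGraph V} (D : G.EdgeOrientation)
    (M : G.Subgraph) (l : Fin (Nat.card V) ≃ V) : Prop :=
  ∀ i j : Fin (Nat.card V), Even i.val → j.val = i.val + 1 →
    M.Adj (l i) (l j) ∧ D.arc (l i) (l j)

open Classical in
/-- The sign `sign_D(M)` of the perfect matching `M` in the orientation `D`, with respect to the
ordering `ω` of the vertices: the sign of the permutation `(u₁, v₁, …, uₙ, vₙ)`. It does not depend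
on the listing, see `matchingSign_eq`. -/
def EdgeOrientation.matchingSign {V : Type*} {G : SimpleGraph V} (D : G.EdgeOrientation)
    (ω : Fin (Nat.card V) ≃ V) (M : G.Subgraph) : ℤˣ :=
  if h : ∃ l, D.IsListing M l then Equiv.Perm.sign (h.choose.trans ω.symm) else 1

/-- The Pfaffian `Pf(A_D) = ∑_M sign_D(M) ∏_{e ∈ M} x_e` of the weighted skew-adjacency matrix of
the orientation `D`, with respect to the ordering `ω` of the vertices. -/
def EdgeOrientation.pfaffian {V : Type*} [Finite V] {G : SimpleGraph V} (D : G.EdgeOrientation)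
    (ω : Fin (Nat.card V) ≃ V) : MvPolynomial G.edgeSet ℝ :=
  ∑ M ∈ G.perfectMatchings,
    MvPolynomial.C (((D.matchingSign ω M : ℤˣ) : ℤ) : ℝ) * matchingMonomial M

/-- `G` is `k`-Pfaffian: `PM(G)` is a real linear combination of `k` Pfaffians of orientations
of `G`. The vertices are put in some fixed order; another order would multiply all the Pfaffians by
one common sign, see `pfaffian_reorder`. -/
def IsKPfaffian {V : Type*} [Finite V] (G : SimpleGraph V) (k : ℕ) : Prop :=
  ∃ (D : Fin k → G.EdgeOrientation) (c : Fin k → ℝ),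
    G.matchingPolynomial =
      ∑ i, MvPolynomial.C (c i) * (D i).pfaffian (Finite.equivFin V).symm

/-- The Pfaffian number `pf(G)`: the least positive `k` such that `G` is `k`-Pfaffian. -/
def pfaffianNumber {V : Type*} [Finite V] (G : SimpleGraph V) : ℕ :=
  sInf {k : ℕ | 0 < k ∧ G.IsKPfaffian k}

/-! ### Embeddings in surfaces, orientable genus -/

/-- An embedding (drawing without crossings) of the graph `G` in the topological space `S`:
distinct vertices go to distinct points, every edge goes to a simple arc joining the images of its
two ends, the interior of an arc contains no vertex and meets no other arc. -/
structure SpaceEmbedding {V : Type*} (G : SimpleGraph V) (S : Type*) [TopologicalSpace S] where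
  point : V → S
  arc : G.edgeSet → C(I, S)
  point_injective : Function.Injective point
  arc_injective : ∀ e, Function.Injective (arc e)
  arc_ends : ∀ e : G.edgeSet, s(arc e 0, arc e 1) = (e : Sym2 V).map point
  arc_ne_point : ∀ e, ∀ t ∈ Set.Ioo (0 : I) 1, ∀ v, arc e t ≠ point v
  arc_ne_arc : ∀ e e', e ≠ e' → ∀ t ∈ Set.Ioo (0 : I) 1, ∀ t', arc e t ≠ arc e' t'

end SimpleGraph

/-- A solid rectangular block in `ℝ³` with `g` parallel square tunnels drilled through it. -/
def drilledBlock (g : ℕ) : Set (ℝ × ℝ × ℝ) :=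
  {p | (0 ≤ p.1 ∧ p.1 ≤ 2 * g + 1) ∧ (0 ≤ p.2.1 ∧ p.2.1 ≤ 3) ∧ (0 ≤ p.2.2 ∧ p.2.2 ≤ 1) ∧
    ∀ i : ℕ, i < g →
      ¬ ((2 * i + 1 < p.1 ∧ p.1 < 2 * i + 2) ∧ (1 < p.2.1 ∧ p.2.1 < 2))}

/-- The closed orientable surface with `g` handles, realised as the boundary of a solid block with
`g` tunnels (for `g = 0` a sphere, for `g = 1` a torus). By the classification of surfaces it is,
up to homeomorphism, the only closed connected orientable surface of genus `g`. -/
def orientableSurface (g : ℕ) : Set (ℝ × ℝ × ℝ) := frontier (drilledBlock g)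

namespace SimpleGraph

/-- The orientable genus `γ(G)`: the least `g` such that `G` embeds in the orientable surface with
`g` handles. -/
def orientableGenus {V : Type*} (G : SimpleGraph V) : ℕ∞ :=
  sInf {n : ℕ∞ | ∃ g : ℕ, n = g ∧ Nonempty (G.SpaceEmbedding (orientableSurface g))}

/-- `pf_max(g)`: the largest Pfaffian number among all finite graphs of orientable genus at most
`g`, as a supremum in `ℕ ∪ {∞}`. -/
def maxPfaffianNumber (g : ℕ) : ℕ∞ :=
  sSup {k : ℕ∞ | ∃ (V : Type) (_ : Finite V) (G : SimpleGraph V),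
    G.orientableGenus ≤ g ∧ k = G.pfaffianNumber}

/-- The disjoint union of `r` copies of `G`. -/
def disjointCopies {V : Type*} (G : SimpleGraph V) (r : ℕ) : SimpleGraph (Fin r × V) where
  Adj a b := a.1 = b.1 ∧ G.Adj a.2 b.2
  symm := ⟨fun _ _ h => ⟨h.1.symm, h.2.symm⟩⟩
  loopless := ⟨fun _ h => G.loopless.irrefl _ h.2⟩

/-! ### The sign of a matching and the Pfaffian are well defined -/

theorem sign_eq_one_of_pairs {m : ℕ} (hm : Even m) (p : Equiv.Perm (Fin m))
    (h1 : ∀ i : Fin m, Even i.val → Even (p i).val)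
    (h2 : ∀ i j : Fin m, Even i.val → j.val = i.val + 1 → (p j).val = (p i).val + 1) :
    Equiv.Perm.sign p = 1 := by
  classical
  obtain ⟨n, rfl⟩ : ∃ n, m = n * 2 := by
    obtain ⟨n, hn⟩ := hm
    exact ⟨n, by omega⟩
  let a : Fin n → Fin (n * 2) := fun i => ⟨2 * i.val, by omega⟩
  let q : Fin n → Fin n := fun i => ⟨(p (a i)).val / 2, by omega⟩
  have ha : ∀ i, Even (a i).val := fun i => ⟨i.val, by simp only [a]; omega⟩
  have hq : Function.Injective q := by
    intro i j hij
    have hv : (p (a i)).val / 2 = (p (a j)).val / 2 := congrArg Fin.val hij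
    obtain ⟨x, hx⟩ := h1 _ (ha i)
    obtain ⟨y, hy⟩ := h1 _ (ha j)
    have : p (a i) = p (a j) := Fin.ext (by omega)
    have h3 : (a i).val = (a j).val := congrArg Fin.val (p.injective this)
    simp only [a] at h3
    exact Fin.ext (by omega)
  let Q : Equiv.Perm (Fin n) := Equiv.ofBijective q (Finite.injective_iff_bijective.mp hq)
  have key : p = finProdFinEquiv.permCongr (Equiv.prodCongrLeft (fun _ : Fin 2 => Q)) := by
    ext k
    obtain ⟨⟨i, j⟩, rfl⟩ := finProdFinEquiv.surjective k
    rw [Equiv.permCongr_apply, Equiv.symm_apply_apply, Equiv.prodCongrLeft_apply]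
    simp only [finProdFinEquiv_apply_val, Q, Equiv.ofBijective_apply, q]
    obtain ⟨x, hx⟩ := h1 _ (ha i)
    have hj : j = 0 ∨ j = 1 := by omega
    rcases hj with rfl | rfl
    · have : finProdFinEquiv (i, (0 : Fin 2)) = a i := Fin.ext (by simp [a])
      rw [this]
      simp only [Fin.val_zero]
      omega
    · have := h2 (a i) (finProdFinEquiv (i, (1 : Fin 2))) (ha i) (by simp [a]; omega)
      rw [this]
      simp only [Fin.val_one]
      omega
  rw [key, Equiv.Perm.sign_permCongr, Equiv.Perm.sign_prodCongrLeft]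
  simp

theorem EdgeOrientation.sign_listing_eq {V : Type*} [Finite V] {G : SimpleGraph V}
    (D : G.EdgeOrientation) (ω : Fin (Nat.card V) ≃ V) {M : G.Subgraph}
    (hM : M.IsPerfectMatching) {l l' : Fin (Nat.card V) ≃ V}
    (hl : D.IsListing M l) (hl' : D.IsListing M l') :
    Equiv.Perm.sign (l'.trans ω.symm) = Equiv.Perm.sign (l.trans ω.symm) := by
  classical
  have heven : Even (Nat.card V) := by
    have := Fintype.ofFinite V
    rw [Nat.card_eq_fintype_card]
    exact hM.even_card
  have huniq : ∀ {u v w : V}, M.Adj u v → M.Adj u w → v = w := by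
    intro u v w h h'
    exact (Subgraph.isPerfectMatching_iff.mp hM u).unique h h'
  have main : ∀ i j : Fin (Nat.card V), Even i.val → j.val = i.val + 1 →
      Even (l.symm (l' i)).val ∧ (l.symm (l' j)).val = (l.symm (l' i)).val + 1 := by
    intro i j hi hj
    obtain ⟨hadj, harc⟩ := hl' i j hi hj
    set x := l.symm (l' i) with hx
    have hxl : l x = l' i := by simp [hx]
    rcases Nat.even_or_odd x.val with hev | hodd
    · refine ⟨hev, ?_⟩
      have hlt : x.val + 1 < Nat.card V := by
        have := x.isLt
        obtain ⟨y, hy⟩ := heven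
        obtain ⟨z, hz⟩ := hev
        omega
      have h := (hl x ⟨x.val + 1, hlt⟩ hev rfl).1
      rw [hxl] at h
      rw [huniq hadj h, Equiv.symm_apply_apply]
    · exfalso
      obtain ⟨y, hy⟩ := hodd
      have h := hl ⟨2 * y, by have := x.isLt; omega⟩ x ⟨y, by simp only; omega⟩ hy
      rw [hxl] at h
      have := huniq hadj h.1.symm
      rw [← this] at h
      exact D.asymm _ _ harc h.2
  have hp : Equiv.Perm.sign (l'.trans l.symm) = 1 := by
    refine sign_eq_one_of_pairs heven _ (fun i hi => ?_) (fun i j hi hj => (main i j hi hj).2)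
    have hlt : i.val + 1 < Nat.card V := by
      have := i.isLt
      obtain ⟨y, hy⟩ := heven
      obtain ⟨z, hz⟩ := hi
      omega
    exact (main i ⟨i.val + 1, hlt⟩ hi rfl).1
  have : l'.trans ω.symm = (l.trans ω.symm) * (l'.trans l.symm) := by
    ext k
    simp [Equiv.Perm.mul_apply]
  rw [this, Equiv.Perm.sign_mul, hp, mul_one]

/-- The sign of a perfect matching can be computed from any listing. -/
theorem EdgeOrientation.matchingSign_eq {V : Type*} [Finite V] {G : SimpleGraph V}
    (D : G.EdgeOrientation) (ω : Fin (Nat.card V) ≃ V) {M : G.Subgraph}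
    (hM : M.IsPerfectMatching) {l : Fin (Nat.card V) ≃ V} (hl : D.IsListing M l) :
    D.matchingSign ω M = Equiv.Perm.sign (l.trans ω.symm) := by
  have h : ∃ l, D.IsListing M l := ⟨l, hl⟩
  rw [matchingSign, dif_pos h]
  exact D.sign_listing_eq ω hM hl h.choose_spec

/-- Every perfect matching has a listing, in every orientation. -/
theorem EdgeOrientation.exists_isListing {V : Type*} [Finite V] {G : SimpleGraph V}
    (D : G.EdgeOrientation) {M : G.Subgraph} (hM : M.IsPerfectMatching) :
    ∃ l, D.IsListing M l := by
  classical
  have hM' := Subgraph.isPerfectMatching_iff.mp hM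
  choose f hf hf' using hM'
  have hff : ∀ v, f (f v) = v := fun v => (hf' (f v) v (hf v).symm).symm
  have hinj : ∀ {u v}, f u = f v → u = v := fun {u v} h => by rw [← hff u, h, hff]
  let H := {u : V // D.arc u (f u)}
  let F : H × Fin 2 → V := fun x => if x.2 = 0 then x.1.1 else f x.1.1
  have hF : Function.Bijective F := by
    constructor
    · rintro ⟨⟨u, hu⟩, i⟩ ⟨⟨v, hv⟩, j⟩ h
      have hi : i = 0 ∨ i = 1 := by omega
      have hj : j = 0 ∨ j = 1 := by omega
      rcases hi with rfl | rfl <;> rcases hj with rfl | rfl <;> simp [F] at h ⊢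
      · exact Subtype.ext h
      · subst h
        rw [hff] at hu
        exact D.asymm _ _ hu hv
      · subst h
        rw [hff] at hv
        exact D.asymm _ _ hu hv
      · exact Subtype.ext (hinj h)
    · intro v
      rcases (D.adj_iff _ _).mp (M.adj_sub (hf v)) with h | h
      · exact ⟨(⟨v, h⟩, 0), by simp [F]⟩
      · exact ⟨(⟨f v, by rwa [hff]⟩, 1), by simp [F, hff]⟩
  have hcard : Nat.card V = Nat.card H * 2 := by
    rw [← Nat.card_congr (Equiv.ofBijective F hF), Nat.card_prod, Nat.card_fin]
  let e : Fin (Nat.card H * 2) ≃ V :=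
    (finProdFinEquiv.symm.trans
      ((Finite.equivFin H).symm.prodCongr (Equiv.refl _))).trans (Equiv.ofBijective F hF)
  refine ⟨(finCongr hcard).trans e, fun i j hi hj => ?_⟩
  obtain ⟨x, hx⟩ := hi
  have hxlt : x < Nat.card H := by have := i.isLt; omega
  have e1 : finCongr hcard i = finProdFinEquiv ((⟨x, hxlt⟩ : Fin _), (0 : Fin 2)) :=
    Fin.ext (by simp; omega)
  have e2 : finCongr hcard j = finProdFinEquiv ((⟨x, hxlt⟩ : Fin _), (1 : Fin 2)) :=
    Fin.ext (by simp; omega)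
  simp only [Equiv.trans_apply, e1, e2, e, Equiv.symm_apply_apply, Equiv.prodCongr_apply,
    Prod.map_apply, Equiv.refl_apply, Equiv.ofBijective_apply, F, if_true]
  rw [if_neg (by decide)]
  exact ⟨hf _, ((Finite.equivFin H).symm ⟨x, hxlt⟩).2⟩

/-- Changing the ordering of the vertices multiplies all Pfaffians by one common sign. -/
theorem EdgeOrientation.pfaffian_reorder {V : Type*} [Finite V] {G : SimpleGraph V}
    (D : G.EdgeOrientation) (ω ω' : Fin (Nat.card V) ≃ V) :
    D.pfaffian ω' =
      MvPolynomial.C (((Equiv.Perm.sign (ω.trans ω'.symm) : ℤˣ) : ℤ) : ℝ) * D.pfaffian ω := by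
  rw [pfaffian, pfaffian, Finset.mul_sum]
  refine Finset.sum_congr rfl fun M hM => ?_
  have hM : M.IsPerfectMatching := by simpa [perfectMatchings] using hM
  obtain ⟨l, hl⟩ := D.exists_isListing hM
  rw [D.matchingSign_eq ω hM hl, D.matchingSign_eq ω' hM hl]
  have : l.trans ω'.symm = (ω.trans ω'.symm) * (l.trans ω.symm) := by
    ext k
    simp [Equiv.Perm.mul_apply]
  rw [this, Equiv.Perm.sign_mul, ← mul_assoc, ← MvPolynomial.C_mul]
  push_cast
  rfl

end SimpleGraph

end

/-!
The lower bound compares coefficients. Writing `PM(G)` as `∑ cᵢ Pf(A_{Dᵢ})` means that the vectors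
of matching signs of the orientations `Dᵢ`, weighted by the `cᵢ`, add up to the all-ones vector
(`isKPfaffian_iff`). In a bipartite graph the sign of the matching given by a bijection `τ` of the
parts is, up to a global sign, `sgn τ ∏ ε(x, τ x)`, where `ε` records the directions of the edges
(`exists_matchingSign_eq`). So for `g` copies of `K₃,₃` the sign vectors are tensor products of `g`
vectors in `{±1}⁶`, and each factor `u` is odd, that is, its entries have product `-1`
(`prod_sign_mul_prod_eq_neg_one`).

The test functionals are the tensor products of even sign vectors `w ∈ {±1}⁶`. The sum of the
entries of `w` is `2` modulo `4`, so a test functional never vanishes on the all-ones tensor. For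
odd `u`, however, `⟨w, u⟩` is a multiple of `4`, and the mean of `⟨w, u⟩²` over all `w` is `6`; so
`⟨w, u⟩ ≠ 0` for at most a fraction `6/16 = 3/8` of the `w` (`card_signInner_ne_zero_le`). A given
tensor product of odd vectors is therefore not annihilated by at most a fraction `(3/8)^g` of the
test functionals, while each test functional must fail to annihilate one of the `k` terms: `k ≥
(8/3)^g` (`pow_le_of_sum_tensor_eq_one`).

Since the Pfaffian number is an infimum in `ℕ`, which is `0` for the empty set, one also needs that
some `k` works. This holds because the sign vectors of all orientations satisfy an orthogonality
relation (`exists_isKPfaffian`).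

For the genus, one copy of `K₃,₃` is drawn around each tunnel of the block. `K₃,₃` minus an edge is
drawn with straight edges on the top, so that the two ends of the missing edge lie in the face of
the mouth of the tunnel and in the outer face; the missing edge then goes through the tunnel and
returns along the bottom and the side (`copiesEmbedding`).
-/

noncomputable section

namespace SimpleGraph

/-! ### Pfaffian representations as linear systems -/

section Coefficients

variable {V : Type*} [Finite V] {G : SimpleGraph V}

theorem mem_perfectMatchings {M : G.Subgraph} :
    M ∈ G.perfectMatchings ↔ M.IsPerfectMatching := by
  simp [perfectMatchings]

/-- The exponent vector of the monomial `∏_{e ∈ M} x_e`. -/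
def edgeExponent (M : G.Subgraph) : G.edgeSet →₀ ℕ :=
  ∑ e ∈ (Set.toFinite {e : G.edgeSet | (e : Sym2 V) ∈ M.edgeSet}).toFinset, Finsupp.single e 1

theorem matchingMonomial_eq_monomial (M : G.Subgraph) :
    matchingMonomial M = MvPolynomial.monomial (edgeExponent M) 1 := by
  rw [edgeExponent, MvPolynomial.monomial_sum_one]
  rfl

theorem edgeExponent_ne_zero_iff (M : G.Subgraph) (e : G.edgeSet) :
    edgeExponent M e ≠ 0 ↔ (e : Sym2 V) ∈ M.edgeSet := by
  classical
  simp [edgeExponent, Finsupp.finsetSum_apply, Finsupp.single_apply]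

theorem edgeExponent_injOn :
    Set.InjOn (edgeExponent (G := G)) {M | M.IsPerfectMatching} := by
  intro M hM M' hM' h
  have hle : ∀ {N N' : G.Subgraph}, edgeExponent N = edgeExponent N' →
      ∀ u v, N.Adj u v → N'.Adj u v := by
    intro N N' h u v huv
    have h1 := (edgeExponent_ne_zero_iff N ⟨s(u, v), N.adj_sub huv⟩).mpr huv
    rw [h] at h1
    exact (edgeExponent_ne_zero_iff N' _).mp h1
  refine Subgraph.ext ?_ ?_
  · rw [Subgraph.isSpanning_iff.mp hM.2, Subgraph.isSpanning_iff.mp hM'.2]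
  · funext u v
    exact propext ⟨hle h u v, hle h.symm u v⟩

/-- Comparing the coefficients of the monomials turns a representation of `PM(G)` by Pfaffians into
one linear equation for each perfect matching. -/
theorem isKPfaffian_iff {k : ℕ} :
    G.IsKPfaffian k ↔ ∃ (D : Fin k → G.EdgeOrientation) (c : Fin k → ℝ),
      ∀ M : G.Subgraph, M.IsPerfectMatching →
        ∑ i, c i * (((D i).matchingSign (Finite.equivFin V).symm M : ℤˣ) : ℤ) = 1 := by
  classical
  have key : ∀ (D : Fin k → G.EdgeOrientation) (c : Fin k → ℝ),
      ∑ i, MvPolynomial.C (c i) * (D i).pfaffian (Finite.equivFin V).symm =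
        ∑ M ∈ G.perfectMatchings, MvPolynomial.monomial (edgeExponent M)
          (∑ i, c i * (((D i).matchingSign (Finite.equivFin V).symm M : ℤˣ) : ℤ) : ℝ) := by
    intro D c
    simp only [EdgeOrientation.pfaffian, Finset.mul_sum]
    rw [Finset.sum_comm]
    refine Finset.sum_congr rfl fun M _ => ?_
    rw [map_sum]
    refine Finset.sum_congr rfl fun i _ => ?_
    rw [matchingMonomial_eq_monomial, ← mul_assoc, ← MvPolynomial.C_mul,
      MvPolynomial.C_mul_monomial, mul_one]
  have coeff : ∀ (a : G.Subgraph → ℝ) (M : G.Subgraph), M.IsPerfectMatching →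
      MvPolynomial.coeff (edgeExponent M)
        (∑ N ∈ G.perfectMatchings, MvPolynomial.monomial (edgeExponent N) (a N)) = a M := by
    intro a M hM
    rw [MvPolynomial.coeff_sum, Finset.sum_eq_single M]
    · simp
    · intro N hN hNM
      rw [MvPolynomial.coeff_monomial, if_neg]
      exact fun h => hNM (edgeExponent_injOn (mem_perfectMatchings.mp hN) hM h)
    · exact fun h => absurd (mem_perfectMatchings.mpr hM) h
  have hPM : G.matchingPolynomial =
      ∑ M ∈ G.perfectMatchings, MvPolynomial.monomial (edgeExponent M) (1 : ℝ) :=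
    Finset.sum_congr rfl fun M _ => matchingMonomial_eq_monomial M
  refine exists_congr fun D => exists_congr fun c => ?_
  rw [key, hPM]
  constructor
  · intro h M hM
    have := congrArg (MvPolynomial.coeff (edgeExponent M)) h
    rw [coeff _ M hM, coeff _ M hM] at this
    exact this.symm
  · intro h
    refine Finset.sum_congr rfl fun M hM => ?_
    rw [h M (mem_perfectMatchings.mp hM)]

end Coefficients

/-! ### Matching signs in bipartite graphs -/

section Bipartite

variable {V X : Type*} {G : SimpleGraph V}

open Classical in
/-- The direction of the edge `uv` as a sign: `1` if it is directed from `u` to `v`, and `-1`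
otherwise. -/
def EdgeOrientation.dirSign (D : G.EdgeOrientation) (u v : V) : ℤˣ :=
  if D.arc u v then 1 else -1

/-- The matching of a bipartite graph with parts indexed by `X` that joins each `x` on the left to
`τ x` on the right. -/
def matchingOfPerm (φ : X ⊕ X ≃ V) (τ : Equiv.Perm X)
    (h : ∀ x, G.Adj (φ (.inl x)) (φ (.inr (τ x)))) : G.Subgraph where
  verts := Set.univ
  Adj u v := ∃ x, (u = φ (.inl x) ∧ v = φ (.inr (τ x))) ∨ (v = φ (.inl x) ∧ u = φ (.inr (τ x)))
  adj_sub := by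
    rintro u v ⟨x, ⟨rfl, rfl⟩ | ⟨rfl, rfl⟩⟩
    · exact h x
    · exact (h x).symm
  edge_vert _ := Set.mem_univ _
  symm := ⟨fun _ _ ⟨x, hx⟩ => ⟨x, hx.symm⟩⟩

theorem matchingOfPerm_adj (φ : X ⊕ X ≃ V) (τ : Equiv.Perm X)
    (h : ∀ x, G.Adj (φ (.inl x)) (φ (.inr (τ x)))) (x : X) :
    (matchingOfPerm φ τ h).Adj (φ (.inl x)) (φ (.inr (τ x))) :=
  ⟨x, .inl ⟨rfl, rfl⟩⟩

theorem matchingOfPerm_isPerfectMatching (φ : X ⊕ X ≃ V) (τ : Equiv.Perm X)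
    (h : ∀ x, G.Adj (φ (.inl x)) (φ (.inr (τ x)))) :
    (matchingOfPerm φ τ h).IsPerfectMatching := by
  rw [Subgraph.isPerfectMatching_iff]
  intro v
  obtain ⟨x | y, rfl⟩ := φ.surjective v
  · refine ⟨φ (.inr (τ x)), matchingOfPerm_adj φ τ h x, ?_⟩
    rintro w ⟨x', ⟨h1, rfl⟩ | ⟨rfl, h2⟩⟩ <;> simp_all
  · refine ⟨φ (.inl (τ.symm y)), ⟨τ.symm y, .inr ⟨rfl, by simp⟩⟩, ?_⟩
    rintro w ⟨x', ⟨h1, rfl⟩ | ⟨rfl, h2⟩⟩ <;> simp_all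

/-- Every perfect matching of a bipartite graph comes from a bijection between the parts. -/
theorem Subgraph.IsPerfectMatching.exists_perm [Finite X] (φ : X ⊕ X ≃ V)
    (hG : ∀ x y, ¬ G.Adj (φ (.inl x)) (φ (.inl y))) {M : G.Subgraph} (hM : M.IsPerfectMatching) :
    ∃ τ : Equiv.Perm X, ∀ x, M.Adj (φ (.inl x)) (φ (.inr (τ x))) := by
  have hM' := Subgraph.isPerfectMatching_iff.mp hM
  have h : ∀ x, ∃ y, M.Adj (φ (.inl x)) (φ (.inr y)) := by
    intro x
    obtain ⟨v, hv, -⟩ := hM' (φ (.inl x))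
    obtain ⟨y | y, rfl⟩ := φ.surjective v
    · exact absurd (M.adj_sub hv) (hG x y)
    · exact ⟨y, hv⟩
  choose f hf using h
  have hinj : Function.Injective f := by
    intro x y hxy
    have h1 := (hf x).symm
    rw [hxy] at h1
    simpa using (hM' _).unique h1 (hf y).symm
  exact ⟨Equiv.ofBijective f (Finite.injective_iff_bijective.mp hinj), hf⟩

/-- In a bipartite graph the Pfaffian is, up to a global sign, the determinant of the signed
biadjacency matrix. -/
theorem exists_matchingSign_eq [Finite V] [Fintype X] [DecidableEq X] (φ : X ⊕ X ≃ V)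
    (ω : Fin (Nat.card V) ≃ V) :
    ∃ κ : ℤˣ, ∀ (D : G.EdgeOrientation) (M : G.Subgraph) (τ : Equiv.Perm X),
      M.IsPerfectMatching → (∀ x, M.Adj (φ (.inl x)) (φ (.inr (τ x)))) →
      D.matchingSign ω M =
        κ * (Equiv.Perm.sign τ * ∏ x, D.dirSign (φ (.inl x)) (φ (.inr (τ x)))) := by
  classical
  let β : X × Fin 2 ≃ V :=
    ((Equiv.prodComm X (Fin 2)).trans
      ((finTwoEquiv.prodCongr (Equiv.refl X)).trans (Equiv.boolProdEquivSum X))).trans φ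
  have hβ0 : ∀ x, β (x, 0) = φ (.inl x) := fun x => rfl
  have hβ1 : ∀ x, β (x, 1) = φ (.inr x) := fun x => rfl
  have hcard : Nat.card V = Nat.card X * 2 := by
    rw [← Nat.card_congr β, Nat.card_prod, Nat.card_fin]
  let b : Fin (Nat.card V) ≃ X × Fin 2 :=
    (finCongr hcard).trans (finProdFinEquiv.symm.trans
      ((Finite.equivFin X).symm.prodCongr (Equiv.refl _)))
  refine ⟨Equiv.Perm.sign (b.trans (β.trans ω.symm)), fun D M τ hM hτ => ?_⟩
  let ε : X → ℤˣ := fun x => D.dirSign (φ (.inl x)) (φ (.inr (τ x)))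
  let P : Equiv.Perm (X × Fin 2) :=
    Equiv.prodCongrRight fun x => if ε x = 1 then 1 else Equiv.swap 0 1
  let Q : Equiv.Perm (X × Fin 2) := Equiv.prodCongrLeft fun t => if t = 1 then τ else 1
  have hP : Equiv.Perm.sign P = ∏ x, ε x := by
    rw [Equiv.Perm.sign_prodCongrRight]
    refine Finset.prod_congr rfl fun x _ => ?_
    rcases Int.units_eq_one_or (ε x) with h | h <;> simp [h]
  have hQ : Equiv.Perm.sign Q = Equiv.Perm.sign τ := by
    rw [Equiv.Perm.sign_prodCongrLeft]
    simp
  have hl : D.IsListing M (b.trans ((Q * P : Equiv.Perm _).trans β)) := by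
    intro i j hi hj
    obtain ⟨m, hm⟩ := hi
    have hlt : m < Nat.card X := by have := i.isLt; omega
    have e1 : finCongr hcard i = finProdFinEquiv ((⟨m, hlt⟩ : Fin _), (0 : Fin 2)) :=
      Fin.ext (by simp; omega)
    have e2 : finCongr hcard j = finProdFinEquiv ((⟨m, hlt⟩ : Fin _), (1 : Fin 2)) :=
      Fin.ext (by simp; omega)
    set x := (Finite.equivFin X).symm ⟨m, hlt⟩ with hx
    have b1 : b i = (x, 0) := by simp [b, e1, hx]
    have b2 : b j = (x, 1) := by simp [b, e2, hx]
    have hadj := hτ x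
    simp only [Equiv.trans_apply, Equiv.Perm.mul_apply, b1, b2, P, Q, Equiv.prodCongrRight_apply,
      Equiv.prodCongrLeft_apply]
    by_cases h : D.arc (φ (.inl x)) (φ (.inr (τ x)))
    · have hε : ε x = 1 := by simp [ε, EdgeOrientation.dirSign, h]
      simp only [hε, if_true]
      simp [hβ0, hβ1, hadj, h]
    · have hε : ε x ≠ 1 := by
        simp only [ε, EdgeOrientation.dirSign, h]
        decide
      simp only [hε, if_false]
      simp [hβ0, hβ1, hadj.symm, ((D.adj_iff _ _).mp (M.adj_sub hadj)).resolve_left h]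
  rw [D.matchingSign_eq ω hM hl]
  have : (b.trans ((Q * P : Equiv.Perm _).trans β)).trans ω.symm =
      (b.trans (β.trans ω.symm)) * (b.symm.permCongr (Q * P)) := by
    ext k
    simp [Equiv.Perm.mul_apply, Equiv.permCongr_apply]
  rw [this, Equiv.Perm.sign_mul, Equiv.Perm.sign_permCongr, Equiv.Perm.sign_mul, hP, hQ]

/-- The orientation of a bipartite graph in which a sign `1` at `(x, y)` directs the edge from the
left vertex `x` to the right vertex `y`, and a sign `-1` the other way. -/
def orientationOfSigns (φ : X ⊕ X ≃ V)
    (hl : ∀ x y, ¬ G.Adj (φ (.inl x)) (φ (.inl y)))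
    (hr : ∀ x y, ¬ G.Adj (φ (.inr x)) (φ (.inr y))) (ε : X × X → ℤˣ) : G.EdgeOrientation where
  arc u v := G.Adj u v ∧
    ∃ x y, (u = φ (.inl x) ∧ v = φ (.inr y) ∧ ε (x, y) = 1) ∨
      (v = φ (.inl x) ∧ u = φ (.inr y) ∧ ε (x, y) = -1)
  adj_iff u v := by
    refine ⟨fun h => ?_, fun h => h.elim (fun h => h.1) (fun h => h.1.symm)⟩
    obtain ⟨x | x, rfl⟩ := φ.surjective u <;> obtain ⟨y | y, rfl⟩ := φ.surjective v
    · exact absurd h (hl x y)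
    · rcases Int.units_eq_one_or (ε (x, y)) with hε | hε
      · exact .inl ⟨h, x, y, .inl ⟨rfl, rfl, hε⟩⟩
      · exact .inr ⟨h.symm, x, y, .inr ⟨rfl, rfl, hε⟩⟩
    · rcases Int.units_eq_one_or (ε (y, x)) with hε | hε
      · exact .inr ⟨h.symm, y, x, .inl ⟨rfl, rfl, hε⟩⟩
      · exact .inl ⟨h, y, x, .inr ⟨rfl, rfl, hε⟩⟩
    · exact absurd h (hr x y)
  asymm := by
    rintro u v ⟨-, x, y, ⟨rfl, rfl, h1⟩ | ⟨rfl, rfl, h1⟩⟩ ⟨-, x', y', ⟨h2, h3, h4⟩ | ⟨h2, h3, h4⟩⟩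
    · simp at h2
    · simp only [EmbeddingLike.apply_eq_iff_eq, Sum.inl.injEq, Sum.inr.injEq] at h2 h3
      subst h2 h3
      rw [h1] at h4
      exact absurd h4 (by decide)
    · simp only [EmbeddingLike.apply_eq_iff_eq, Sum.inl.injEq, Sum.inr.injEq] at h2 h3
      subst h2 h3
      rw [h1] at h4
      exact absurd h4 (by decide)
    · simp at h2

theorem dirSign_orientationOfSigns (φ : X ⊕ X ≃ V)
    (hl : ∀ x y, ¬ G.Adj (φ (.inl x)) (φ (.inl y)))
    (hr : ∀ x y, ¬ G.Adj (φ (.inr x)) (φ (.inr y))) (ε : X × X → ℤˣ) {x y : X}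
    (h : G.Adj (φ (.inl x)) (φ (.inr y))) :
    (orientationOfSigns φ hl hr ε).dirSign (φ (.inl x)) (φ (.inr y)) = ε (x, y) := by
  have : (orientationOfSigns φ hl hr ε).arc (φ (.inl x)) (φ (.inr y)) ↔ ε (x, y) = 1 := by
    simp [orientationOfSigns, h]
  rw [EdgeOrientation.dirSign, this]
  rcases Int.units_eq_one_or (ε (x, y)) with h | h <;> simp [h]

/-- Orthogonality: distinct bijections give orthogonal products of independent signs. -/
theorem sum_prod_signs_mul [Fintype X] [DecidableEq X] {ρ τ : Equiv.Perm X} (h : ρ ≠ τ) :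
    ∑ ε : X × X → ℤˣ, (∏ x, (((ε (x, ρ x) : ℤˣ) : ℤ) : ℝ)) * ∏ x, (((ε (x, τ x) : ℤˣ) : ℤ) : ℝ) =
      0 := by
  obtain ⟨x₀, hx₀⟩ : ∃ x, ρ x ≠ τ x := by
    by_contra! h'
    exact h (Equiv.ext h')
  -- Flipping the sign at `(x₀, ρ x₀)` changes the sign of every summand.
  let δ : X × X → ℤˣ := fun p => if p = (x₀, ρ x₀) then -1 else 1
  set F : (X × X → ℤˣ) → ℝ := fun ε =>
    (∏ x, (((ε (x, ρ x) : ℤˣ) : ℤ) : ℝ)) * ∏ x, (((ε (x, τ x) : ℤˣ) : ℤ) : ℝ) with hF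
  have hflip : ∀ ε, F (δ * ε) = - F ε := by
    intro ε
    have h1 : ∏ x, (((δ (x, ρ x) : ℤˣ) : ℤ) : ℝ) = -1 := by
      rw [Finset.prod_eq_single x₀]
      · simp [δ]
      · intro x _ hx
        simp [δ, hx]
      · simp
    have h2 : ∏ x, (((δ (x, τ x) : ℤˣ) : ℤ) : ℝ) = 1 := by
      refine Finset.prod_eq_one fun x _ => ?_
      have : ¬ (x = x₀ ∧ τ x = ρ x₀) := by
        rintro ⟨rfl, h⟩
        exact hx₀ h.symm
      simp [δ, this]
    simp only [hF, Pi.mul_apply, Units.val_mul, Int.cast_mul, Finset.prod_mul_distrib, h1, h2]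
    ring
  have := Equiv.sum_comp (Equiv.mulLeft δ) F
  simp only [Equiv.coe_mulLeft, hflip, Finset.sum_neg_distrib] at this
  linarith

/-- `PM(G)` lies in the span of the Pfaffians: by orthogonality, averaging `sign_D(M) Pf(A_D)` over
all orientations `D` isolates the monomial of the matching `M`. -/
theorem exists_isKPfaffian [Finite V] [Finite X] (φ : X ⊕ X ≃ V)
    (hl : ∀ x y, ¬ G.Adj (φ (.inl x)) (φ (.inl y)))
    (hr : ∀ x y, ¬ G.Adj (φ (.inr x)) (φ (.inr y))) :
    ∃ k, 0 < k ∧ G.IsKPfaffian k := by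
  classical
  have := Fintype.ofFinite X
  obtain ⟨κ, hκ⟩ := exists_matchingSign_eq (G := G) φ (Finite.equivFin V).symm
  let N := Fintype.card (X × X → ℤˣ)
  have hN : 0 < N := Fintype.card_pos
  let e : Fin N ≃ (X × X → ℤˣ) := (Fintype.equivFin _).symm
  let sg : Equiv.Perm X → ℝ := fun ρ => ((Equiv.Perm.sign ρ : ℤˣ) : ℤ)
  let p : (X × X → ℤˣ) → Equiv.Perm X → ℝ := fun ε ρ => ∏ x, (((ε (x, ρ x) : ℤˣ) : ℤ) : ℝ)
  have hsq : ∀ z : ℤˣ, (((z : ℤˣ) : ℤ) : ℝ) * (((z : ℤˣ) : ℤ) : ℝ) = 1 := by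
    intro z
    rcases Int.units_eq_one_or z with h | h <;> simp [h]
  refine ⟨N, hN, isKPfaffian_iff.mpr ⟨fun i => orientationOfSigns φ hl hr (e i),
    fun i => (N : ℝ)⁻¹ * ((κ : ℤ) : ℝ) * ∑ ρ, sg ρ * p (e i) ρ, fun M hM => ?_⟩⟩
  obtain ⟨τ, hτ⟩ := hM.exists_perm φ hl
  have hsign : ∀ ε, ((((orientationOfSigns φ hl hr ε).matchingSign (Finite.equivFin V).symm M :
      ℤˣ) : ℤ) : ℝ) = ((κ : ℤ) : ℝ) * (sg τ * p ε τ) := by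
    intro ε
    rw [hκ _ M τ hM hτ]
    simp only [dirSign_orientationOfSigns φ hl hr ε (M.adj_sub (hτ _)), sg, p]
    push_cast
    rfl
  simp only [hsign]
  rw [Equiv.sum_comp e fun ε => (N : ℝ)⁻¹ * ((κ : ℤ) : ℝ) * (∑ ρ, sg ρ * p ε ρ) *
    (((κ : ℤ) : ℝ) * (sg τ * p ε τ))]
  have h1 : ∀ ε, (N : ℝ)⁻¹ * ((κ : ℤ) : ℝ) * (∑ ρ, sg ρ * p ε ρ) *
      (((κ : ℤ) : ℝ) * (sg τ * p ε τ)) =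
      (N : ℝ)⁻¹ * (∑ ρ, sg ρ * sg τ * (p ε ρ * p ε τ)) := by
    intro ε
    rw [Finset.mul_sum, Finset.mul_sum, Finset.sum_mul]
    refine Finset.sum_congr rfl fun ρ _ => ?_
    linear_combination ((N : ℝ)⁻¹ * sg ρ * p ε ρ * (sg τ * p ε τ)) * hsq κ
  simp only [h1]
  rw [← Finset.mul_sum, Finset.sum_comm, Finset.sum_eq_single τ]
  · have h2 : ∀ ε, sg τ * sg τ * (p ε τ * p ε τ) = 1 := by
      intro ε
      simp only [sg, p, ← Finset.prod_mul_distrib, hsq, Finset.prod_const_one, mul_one]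
    simp only [h2, Finset.sum_const, Finset.card_univ, nsmul_eq_mul, mul_one]
    exact inv_mul_cancel₀ (by exact_mod_cast hN.ne')
  · intro ρ _ hρ
    rw [← Finset.mul_sum]
    simp only [p]
    rw [sum_prod_signs_mul hρ, mul_zero]
  · simp

end Bipartite

end SimpleGraph

/-! ### Sign vectors of length six -/

section SignVectors

variable {ι : Type*} [Fintype ι]

theorem sum_units_modEq_four (v : ι → ℤˣ) :
    ∑ i, ((v i : ℤˣ) : ℤ) ≡ ((∏ i, v i : ℤˣ) : ℤ) - 1 + Fintype.card ι [ZMOD 4] := by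
  classical
  have h : ∀ s : Finset ι,
      ∑ i ∈ s, ((v i : ℤˣ) : ℤ) ≡ ((∏ i ∈ s, v i : ℤˣ) : ℤ) - 1 + s.card [ZMOD 4] := by
    intro s
    induction s using Finset.induction_on with
    | empty => simp
    | insert a s ha ih =>
      rw [Finset.sum_insert ha, Finset.prod_insert ha, Finset.card_insert_of_notMem ha]
      unfold Int.ModEq at ih ⊢
      simp only [Units.val_mul, Nat.cast_add, Nat.cast_one]
      rcases Int.units_eq_one_or (v a) with h | h <;>
        rcases Int.units_eq_one_or (∏ i ∈ s, v i) with h' | h' <;>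
        simp only [h, h', Units.val_one, Units.val_neg] at ih ⊢ <;> omega
  simpa using h Finset.univ

/-- The inner product of two sign vectors. -/
def signInner (w u : ι → ℤˣ) : ℤ := ∑ i, ((w i : ℤˣ) : ℤ) * ((u i : ℤˣ) : ℤ)

theorem signInner_modEq_four (w u : ι → ℤˣ) :
    signInner w u ≡ (((∏ i, w i) * ∏ i, u i : ℤˣ) : ℤ) - 1 + Fintype.card ι [ZMOD 4] := by
  have := sum_units_modEq_four (fun i => w i * u i)
  rw [Finset.prod_mul_distrib] at this
  simpa [signInner] using this

variable (ι) in
/-- The even sign vectors: those with an even number of entries `-1`. -/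
def evenSignVectors [DecidableEq ι] : Finset (ι → ℤˣ) := {w | ∏ i, w i = 1}

variable [DecidableEq ι]

theorem one_mem_evenSignVectors : (1 : ι → ℤˣ) ∈ evenSignVectors ι := by
  simp [evenSignVectors]

theorem sum_evenSignVectors_mul (hι : 3 ≤ Fintype.card ι) {i j : ι} (hij : i ≠ j) :
    ∑ w ∈ evenSignVectors ι, ((w i : ℤˣ) : ℤ) * ((w j : ℤˣ) : ℤ) = 0 := by
  obtain ⟨l, hl⟩ : ∃ l, l ∉ ({i, j} : Finset ι) := by
    by_contra! h
    have h1 := Finset.card_le_card (fun x _ => h x : Finset.univ ⊆ ({i, j} : Finset ι))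
    have h2 := Finset.card_le_two (a := i) (b := j)
    rw [Finset.card_univ] at h1
    omega
  simp only [Finset.mem_insert, Finset.mem_singleton, not_or] at hl
  -- Flipping the entries at `i` and `l` is a sign-reversing involution.
  let δ : ι → ℤˣ := Pi.mulSingle i (-1) * Pi.mulSingle l (-1)
  have hδi : δ i = -1 := by simp [δ, Pi.mulSingle_eq_of_ne (Ne.symm hl.1)]
  have hδj : δ j = 1 := by
    simp [δ, Pi.mulSingle_eq_of_ne hij.symm, Pi.mulSingle_eq_of_ne (Ne.symm hl.2)]
  have hδδ : δ * δ = 1 := by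
    funext x
    exact Int.units_mul_self _
  have hδ : ∏ x, δ x = 1 := by
    simp only [δ, Pi.mul_apply, Finset.prod_mul_distrib, Finset.prod_pi_mulSingle']
    simp
  have hmem : ∀ w ∈ evenSignVectors ι, δ * w ∈ evenSignVectors ι := by
    intro w hw
    simp only [evenSignVectors, Finset.mem_filter_univ, Pi.mul_apply, Finset.prod_mul_distrib,
      hδ, one_mul] at hw ⊢
    exact hw
  have := Finset.sum_nbij' (s := evenSignVectors ι) (t := evenSignVectors ι)
    (f := fun w => ((w i : ℤˣ) : ℤ) * ((w j : ℤˣ) : ℤ))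
    (g := fun w => -(((w i : ℤˣ) : ℤ) * ((w j : ℤˣ) : ℤ)))
    (δ * ·) (δ * ·) hmem hmem
    (fun w _ => by simp only [← mul_assoc, hδδ, one_mul])
    (fun w _ => by simp only [← mul_assoc, hδδ, one_mul])
    (fun w _ => by simp [hδi, hδj])
  rw [Finset.sum_neg_distrib] at this
  omega

/-- The second moment of the inner product with a random even sign vector. -/
theorem sum_signInner_sq (hι : 3 ≤ Fintype.card ι) (u : ι → ℤˣ) :
    ∑ w ∈ evenSignVectors ι, signInner w u ^ 2 =
      (evenSignVectors ι).card * Fintype.card ι := by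
  have h : ∀ w : ι → ℤˣ, signInner w u ^ 2 =
      ∑ i, ∑ j, (((u i : ℤˣ) : ℤ) * ((u j : ℤˣ) : ℤ)) *
        (((w i : ℤˣ) : ℤ) * ((w j : ℤˣ) : ℤ)) := by
    intro w
    rw [signInner, sq, Finset.sum_mul_sum]
    exact Finset.sum_congr rfl fun i _ => Finset.sum_congr rfl fun j _ => by ring
  have hsq : ∀ z : ℤˣ, (z : ℤ) * (z : ℤ) = 1 := by decide
  simp only [h]
  rw [Finset.sum_comm]
  have h2 : ∀ i, ∑ w ∈ evenSignVectors ι, ∑ j, (((u i : ℤˣ) : ℤ) * ((u j : ℤˣ) : ℤ)) *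
      (((w i : ℤˣ) : ℤ) * ((w j : ℤˣ) : ℤ)) = (evenSignVectors ι).card := by
    intro i
    rw [Finset.sum_comm, Finset.sum_eq_single i]
    · simp [hsq]
    · intro j _ hj
      rw [← Finset.mul_sum, sum_evenSignVectors_mul hι hj.symm, mul_zero]
    · simp
  simp only [h2, Finset.sum_const, Finset.card_univ, nsmul_eq_mul]
  ring

/-- At most `6/16` of the even sign vectors of length six are not orthogonal to a given odd one:
the inner products are multiples of `4`, and their mean square is `6`. -/
theorem card_signInner_ne_zero_le (hι : Fintype.card ι = 6) {u : ι → ℤˣ} (hu : ∏ i, u i = -1) :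
    16 * ((evenSignVectors ι).filter fun w => signInner w u ≠ 0).card ≤
      6 * (evenSignVectors ι).card := by
  have h1 := sum_signInner_sq (by omega) u
  have h2 : ∑ w ∈ (evenSignVectors ι).filter (fun w => signInner w u ≠ 0), (16 : ℤ) ≤
      ∑ w ∈ evenSignVectors ι, signInner w u ^ 2 := by
    refine (Finset.sum_le_sum fun w hw => ?_).trans (Finset.sum_le_sum_of_subset_of_nonneg
      (Finset.filter_subset _ _) fun w _ _ => sq_nonneg _)
    rw [Finset.mem_filter] at hw
    have hm := signInner_modEq_four w u
    have hw1 : ∏ i, w i = 1 := by simpa [evenSignVectors] using hw.1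
    rw [hw1, hu, hι] at hm
    obtain ⟨c, hc⟩ : (4 : ℤ) ∣ signInner w u :=
      Int.dvd_of_emod_eq_zero (by simpa [Int.ModEq] using hm)
    have hc0 : c ≠ 0 := by
      rintro rfl
      exact hw.2 (by simpa using hc)
    have : 0 < c ^ 2 := by positivity
    rw [hc]
    nlinarith
  rw [h1, hι, Finset.sum_const, nsmul_eq_mul] at h2
  push_cast at h2
  have h3 : (16 * ((evenSignVectors ι).filter fun w => signInner w u ≠ 0).card : ℤ) ≤
    6 * (evenSignVectors ι).card := by linarith
  exact_mod_cast h3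

/-- The sum of an even sign vector of length six is `2` modulo `4`. -/
theorem sum_ne_zero_of_mem_evenSignVectors (hι : Fintype.card ι = 6) {w : ι → ℤˣ}
    (hw : w ∈ evenSignVectors ι) : ∑ i, ((w i : ℤˣ) : ℤ) ≠ 0 := by
  intro h
  have hm := sum_units_modEq_four w
  have hw1 : ∏ i, w i = 1 := by simpa [evenSignVectors] using hw
  rw [h, hw1, hι] at hm
  exact absurd hm (by decide)

/-- If the all-ones tensor in `(ℝ⁶)^{⊗ g}` is a linear combination of `k` tensor products of odd
sign vectors, then `k ≥ (8/3)^g`. -/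
theorem pow_le_of_sum_tensor_eq_one (hι : Fintype.card ι = 6) {g k : ℕ}
    (s : Fin k → Fin g → ι → ℤˣ) (hs : ∀ i j, ∏ a, s i j a = -1) (c : Fin k → ℝ)
    (h : ∀ f : Fin g → ι, ∑ i, c i * ∏ j, (((s i j (f j) : ℤˣ) : ℤ) : ℝ) = 1) :
    (8 / 3 : ℝ) ^ g ≤ k := by
  set W := evenSignVectors ι
  let B : Fin k → Fin g → Finset (ι → ℤˣ) := fun i j => W.filter fun w => signInner w (s i j) ≠ 0
  -- A product of even sign vectors does not vanish on the all-ones tensor, so it does not vanish on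
  -- one of the `k` terms.
  have hcover : Fintype.piFinset (fun _ : Fin g => W) ⊆
      Finset.univ.biUnion fun i => Fintype.piFinset (B i) := by
    intro w hw
    rw [Fintype.mem_piFinset] at hw
    have hne : (∏ j, ∑ a, (((w j a : ℤˣ) : ℤ) : ℝ)) ≠ 0 := by
      refine Finset.prod_ne_zero_iff.mpr fun j _ => ?_
      exact_mod_cast sum_ne_zero_of_mem_evenSignVectors hι (hw j)
    have hsum : ∏ j, ∑ a, (((w j a : ℤˣ) : ℤ) : ℝ) =
        ∑ i, c i * ∏ j, (signInner (w j) (s i j) : ℝ) := by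
      have e1 : ∀ i, ∏ j, (signInner (w j) (s i j) : ℝ) =
          ∑ f : Fin g → ι, ∏ j,
            ((((w j (f j) : ℤˣ) : ℤ) : ℝ) * (((s i j (f j) : ℤˣ) : ℤ) : ℝ)) := by
        intro i
        simp only [signInner, Int.cast_sum, Int.cast_mul]
        rw [Finset.prod_univ_sum, Fintype.piFinset_univ]
      simp only [e1, Finset.mul_sum]
      rw [Finset.sum_comm, Finset.prod_univ_sum, Fintype.piFinset_univ]
      refine Finset.sum_congr rfl fun f _ => ?_
      calc ∏ j, (((w j (f j) : ℤˣ) : ℤ) : ℝ)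
          = (∏ j, (((w j (f j) : ℤˣ) : ℤ) : ℝ)) *
              ∑ i, c i * ∏ j, (((s i j (f j) : ℤˣ) : ℤ) : ℝ) := by rw [h f, mul_one]
        _ = _ := by
          rw [Finset.mul_sum]
          refine Finset.sum_congr rfl fun i _ => ?_
          rw [Finset.prod_mul_distrib]
          ring
    rw [hsum] at hne
    obtain ⟨i, -, hi⟩ := Finset.exists_ne_zero_of_sum_ne_zero hne
    rw [Finset.mem_biUnion]
    refine ⟨i, Finset.mem_univ _, ?_⟩
    rw [Fintype.mem_piFinset]
    intro j
    have := Finset.prod_ne_zero_iff.mp (right_ne_zero_of_mul hi) j (Finset.mem_univ _)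
    exact Finset.mem_filter.mpr ⟨hw j, by exact_mod_cast this⟩
  have hWpos : 0 < W.card := Finset.card_pos.mpr ⟨1, one_mem_evenSignVectors⟩
  have hcard : W.card ^ g ≤ ∑ i, ∏ j, (B i j).card := by
    have := (Finset.card_le_card hcover).trans Finset.card_biUnion_le
    simpa [Fintype.card_piFinset] using this
  have hB : ∀ i, 16 ^ g * ∏ j, (B i j).card ≤ 6 ^ g * W.card ^ g := by
    intro i
    calc 16 ^ g * ∏ j, (B i j).card = ∏ j, (16 * (B i j).card) := by
          simp [Finset.prod_mul_distrib]
      _ ≤ ∏ _j : Fin g, (6 * W.card) :=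
          Finset.prod_le_prod' fun j _ => card_signInner_ne_zero_le hι (hs i j)
      _ = 6 ^ g * W.card ^ g := by simp [mul_pow]
  have hfin : 16 ^ g * W.card ^ g ≤ k * 6 ^ g * W.card ^ g := by
    calc 16 ^ g * W.card ^ g ≤ ∑ i, 16 ^ g * ∏ j, (B i j).card := by
          rw [← Finset.mul_sum]
          exact Nat.mul_le_mul_left _ hcard
      _ ≤ ∑ _i : Fin k, 6 ^ g * W.card ^ g := Finset.sum_le_sum fun i _ => hB i
      _ = k * 6 ^ g * W.card ^ g := by simp [mul_assoc]
  have h16 : 16 ^ g ≤ k * 6 ^ g := Nat.le_of_mul_le_mul_right hfin (by positivity)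
  have h16' : (16 : ℝ) ^ g ≤ k * 6 ^ g := by exact_mod_cast h16
  rw [show (8 / 3 : ℝ) = 16 / 6 by norm_num, div_pow, div_le_iff₀ (by positivity)]
  exact h16'

end SignVectors

namespace SimpleGraph

/-! ### The Pfaffian number of copies of `K₃,₃` -/

/-- The two sides of the disjoint union of `g` copies of `K₃,₃`. -/
def copiesSides (g : ℕ) : (Fin g × Fin 3) ⊕ (Fin g × Fin 3) ≃ Fin g × (Fin 3 ⊕ Fin 3) :=
  (Equiv.prodSumDistrib _ _ _).symm

theorem copiesSides_inl {g : ℕ} (x : Fin g × Fin 3) : copiesSides g (.inl x) = (x.1, .inl x.2) :=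
  rfl

theorem copiesSides_inr {g : ℕ} (x : Fin g × Fin 3) : copiesSides g (.inr x) = (x.1, .inr x.2) :=
  rfl

/-- The signs of the six perfect matchings of `K₃,₃` have product `-1`: three of the six
permutations are odd, and every edge lies in two perfect matchings. -/
theorem prod_sign_mul_prod_eq_neg_one (ε : Fin 3 → Fin 3 → ℤˣ) :
    ∏ ρ : Equiv.Perm (Fin 3), (Equiv.Perm.sign ρ * ∏ a, ε a (ρ a)) = -1 := by
  have hsign : ∏ ρ : Equiv.Perm (Fin 3), Equiv.Perm.sign ρ = -1 := by decide
  have hε : ∏ ρ : Equiv.Perm (Fin 3), ∏ a, ε a (ρ a) = 1 := by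
    rw [Finset.prod_comm]
    refine Finset.prod_eq_one fun a _ => ?_
    rw [← Finset.prod_fiberwise (g := fun ρ : Equiv.Perm (Fin 3) => ρ a)]
    refine Finset.prod_eq_one fun b _ => ?_
    have hcard : (Finset.univ.filter fun ρ : Equiv.Perm (Fin 3) => ρ a = b).card = 2 := by
      revert a b
      decide
    rw [Finset.prod_congr rfl fun ρ hρ => by rw [(Finset.mem_filter.mp hρ).2],
      Finset.prod_const, hcard, Int.units_sq]
  rw [Finset.prod_mul_distrib, hsign, hε, mul_one]

theorem pow_le_of_isKPfaffian {g k : ℕ}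
    (h : ((completeBipartiteGraph (Fin 3) (Fin 3)).disjointCopies g).IsKPfaffian k) :
    (8 / 3 : ℝ) ^ g ≤ k := by
  classical
  set G := (completeBipartiteGraph (Fin 3) (Fin 3)).disjointCopies g with hG
  obtain ⟨D, c, hDc⟩ := isKPfaffian_iff.mp h
  obtain ⟨κ, hκ⟩ := exists_matchingSign_eq (G := G) (copiesSides g)
    (Finite.equivFin (Fin g × (Fin 3 ⊕ Fin 3))).symm
  let ε : Fin k → Fin g → Fin 3 → Fin 3 → ℤˣ := fun i j a b =>
    (D i).dirSign (copiesSides g (.inl (j, a))) (copiesSides g (.inr (j, b)))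
  refine pow_le_of_sum_tensor_eq_one (ι := Equiv.Perm (Fin 3)) (by decide)
    (fun i j ρ => Equiv.Perm.sign ρ * ∏ a, ε i j a (ρ a))
    (fun i j => prod_sign_mul_prod_eq_neg_one _) (fun i => c i * ((κ : ℤ) : ℝ)) fun f => ?_
  let τ : Equiv.Perm (Fin g × Fin 3) := Equiv.prodCongrRight f
  have hadj : ∀ x, G.Adj (copiesSides g (.inl x)) (copiesSides g (.inr (τ x))) := by
    intro x
    simp [hG, disjointCopies, copiesSides_inl, copiesSides_inr, τ]
  have := hDc _ (matchingOfPerm_isPerfectMatching (copiesSides g) τ hadj)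
  rw [← this]
  refine Finset.sum_congr rfl fun i _ => ?_
  rw [hκ (D i) _ τ (matchingOfPerm_isPerfectMatching _ τ hadj)
    (matchingOfPerm_adj (copiesSides g) τ hadj), Equiv.Perm.sign_prodCongrRight,
    Fintype.prod_prod_type, ← Finset.prod_mul_distrib]
  simp only [τ, Equiv.prodCongrRight_apply, ε]
  push_cast
  ring

theorem pow_le_pfaffianNumber (g : ℕ) : (8 / 3 : ℝ) ^ g ≤
    (((completeBipartiteGraph (Fin 3) (Fin 3)).disjointCopies g).pfaffianNumber : ℝ) := by
  have hne : {k : ℕ | 0 < k ∧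
      ((completeBipartiteGraph (Fin 3) (Fin 3)).disjointCopies g).IsKPfaffian k}.Nonempty :=
    exists_isKPfaffian (copiesSides g)
      (fun x y h => by simp [disjointCopies, copiesSides_inl] at h)
      (fun x y h => by simp [disjointCopies, copiesSides_inr] at h)
  exact pow_le_of_isKPfaffian (Nat.sInf_mem hne).2

end SimpleGraph

/-! ### Points of the surface -/

/-- The translation that moves the first tunnel of the block to the tunnel number `i`. -/
def tunnelShift (i : ℕ) (p : ℝ × ℝ × ℝ) : ℝ × ℝ × ℝ := (2 * i + p.1, p.2)

theorem continuous_tunnelShift (i : ℕ) : Continuous (tunnelShift i) := by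
  unfold tunnelShift
  fun_prop

/-- Different tunnels have disjoint neighbourhoods `3/5 ≤ x - 2i ≤ 12/5`. -/
theorem tunnelShift_inj {i j : ℕ} {p q : ℝ × ℝ × ℝ} (hp : 3 / 5 ≤ p.1 ∧ p.1 ≤ 12 / 5)
    (hq : 3 / 5 ≤ q.1 ∧ q.1 ≤ 12 / 5) (h : tunnelShift i p = tunnelShift j q) :
    i = j ∧ p = q := by
  obtain ⟨h1, h2⟩ := Prod.mk.inj h
  have hij : i = j := by
    rcases lt_trichotomy i j with hlt | heq | hlt
    · have : (i : ℝ) + 1 ≤ j := by exact_mod_cast hlt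
      linarith
    · exact heq
    · have : (j : ℝ) + 1 ≤ i := by exact_mod_cast hlt
      linarith
  subst hij
  exact ⟨rfl, Prod.ext (by linarith) h2⟩

/-- A point of the block near the tunnel number `i` lies on the surface if one leaves the block by
moving from it in some direction `v`. -/
theorem tunnelShift_mem_orientableSurface {g i : ℕ} (hi : i < g) {p : ℝ × ℝ × ℝ}
    (hx : 3 / 5 ≤ p.1 ∧ p.1 ≤ 12 / 5) (hy : 0 ≤ p.2.1 ∧ p.2.1 ≤ 3) (hz : 0 ≤ p.2.2 ∧ p.2.2 ≤ 1)
    (hp : ¬ ((1 < p.1 ∧ p.1 < 2) ∧ (1 < p.2.1 ∧ p.2.1 < 2))) (v : ℝ × ℝ × ℝ)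
    (hv : ∀ s : ℝ, 0 < s → s < 1 → tunnelShift i p + s • v ∉ drilledBlock g) :
    tunnelShift i p ∈ orientableSurface g := by
  rw [orientableSurface, frontier_eq_closure_inter_closure]
  constructor
  · refine subset_closure ⟨⟨?_, ?_⟩, hy, hz, fun j hj => ?_⟩
    · have : (0 : ℝ) ≤ i := Nat.cast_nonneg i
      simp only [tunnelShift]
      linarith
    · have : (i : ℝ) + 1 ≤ g := by exact_mod_cast hi
      simp only [tunnelShift]
      linarith
    · rintro ⟨⟨h1, h2⟩, h3⟩
      simp only [tunnelShift] at h1 h2 h3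
      rcases lt_trichotomy i j with hlt | rfl | hlt
      · have : (i : ℝ) + 1 ≤ j := by exact_mod_cast hlt
        linarith
      · exact hp ⟨⟨by linarith, by linarith⟩, h3⟩
      · have : (j : ℝ) + 1 ≤ i := by exact_mod_cast hlt
        linarith
  · have hcont : Continuous fun s : ℝ => tunnelShift i p + s • v := by fun_prop
    have ht : Filter.Tendsto (fun s : ℝ => tunnelShift i p + s • v) (nhdsWithin 0 (Set.Ioi 0))
        (nhds (tunnelShift i p)) := by
      have := hcont.tendsto 0
      rw [zero_smul, add_zero] at this
      exact this.mono_left nhdsWithin_le_nhds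
    refine mem_closure_of_tendsto ht ?_
    filter_upwards [Ioo_mem_nhdsGT (zero_lt_one (α := ℝ))] with s hs
    exact hv s hs.1 hs.2

theorem top_mem_orientableSurface {g i : ℕ} (hi : i < g) {x y : ℝ}
    (hx : 3 / 5 ≤ x ∧ x ≤ 12 / 5) (hy : 0 ≤ y ∧ y ≤ 3)
    (hxy : ¬ ((1 < x ∧ x < 2) ∧ (1 < y ∧ y < 2))) :
    tunnelShift i (x, y, 1) ∈ orientableSurface g := by
  refine tunnelShift_mem_orientableSurface hi hx hy (by simp) hxy (0, 0, 1) fun s hs _ h => ?_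
  have := h.2.2.1.2
  simp only [tunnelShift, Prod.snd_add, Prod.smul_snd, smul_eq_mul] at this
  linarith

theorem bottom_mem_orientableSurface {g i : ℕ} (hi : i < g) {x y : ℝ}
    (hx : 3 / 5 ≤ x ∧ x ≤ 12 / 5) (hy : 0 ≤ y ∧ y ≤ 3)
    (hxy : ¬ ((1 < x ∧ x < 2) ∧ (1 < y ∧ y < 2))) :
    tunnelShift i (x, y, 0) ∈ orientableSurface g := by
  refine tunnelShift_mem_orientableSurface hi hx hy (by simp) hxy (0, 0, -1) fun s hs _ h => ?_
  have := h.2.2.1.1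
  simp only [tunnelShift, Prod.snd_add, Prod.smul_snd, smul_eq_mul] at this
  linarith

theorem side_mem_orientableSurface {g i : ℕ} (hi : i < g) {x z : ℝ}
    (hx : 3 / 5 ≤ x ∧ x ≤ 12 / 5) (hz : 0 ≤ z ∧ z ≤ 1) :
    tunnelShift i (x, 3, z) ∈ orientableSurface g := by
  refine tunnelShift_mem_orientableSurface hi hx (by simp) hz (fun h => ?_) (0, 1, 0)
    fun s hs _ h => ?_
  · have := h.2.2
    norm_num at this
  · have := h.2.1.2
    simp only [tunnelShift, Prod.snd_add, Prod.smul_snd, Prod.fst_add, Prod.smul_fst,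
      smul_eq_mul] at this
    linarith

/-- The vertical edge of a tunnel above the point `(1, 2)` lies on the surface. -/
theorem tunnelEdge_mem_orientableSurface {g i : ℕ} (hi : i < g) {z : ℝ} (hz : 0 ≤ z ∧ z ≤ 1) :
    tunnelShift i (1, 2, z) ∈ orientableSurface g := by
  refine tunnelShift_mem_orientableSurface hi (by norm_num) (by norm_num) hz (by simp) (1, -1, 0)
    fun s hs hs1 h => h.2.2.2 i hi ?_
  simp only [tunnelShift, Prod.snd_add, Prod.smul_snd, Prod.fst_add, Prod.smul_fst, smul_eq_mul]
  refine ⟨⟨?_, ?_⟩, ?_, ?_⟩ <;> linarith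

namespace SimpleGraph

/-! ### A drawing of `K₃,₃` around one tunnel -/

/-- The position on the top of the block of the vertices of `K₃,₃`. Around the tunnel, whose mouth
is the square `[1, 2] × [1, 2]`, runs the quadrilateral `inl 1, inr 1, inl 2, inr 2`; the vertex
`inl 0` lies inside it, and `inr 0` outside, on the rim of the block. -/
def vertexPosition : Fin 3 ⊕ Fin 3 → ℝ × ℝ
  | .inl a => ![(7 / 10, 3 / 2), (3 / 5, 3 / 2), (12 / 5, 3 / 2)] a
  | .inr b => ![(3 / 2, 3), (3 / 2, 29 / 10), (3 / 2, 1 / 10)] b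

/-- A straight segment on the top of the block. -/
def topPath (p q : ℝ × ℝ) (t : ℝ) : ℝ × ℝ × ℝ :=
  ((1 - t) * p.1 + t * q.1, (1 - t) * p.2 + t * q.2, 1)

/-- The edge from `inl 0` to `inr 0`: on the top to the corner `(1, 2)` of the tunnel, down through
the tunnel, along the bottom to the side of the block, and up on the side. Each of the four parts
takes a quarter of the time. -/
def handlePath (t : ℝ) : ℝ × ℝ × ℝ :=
  (7 / 10 + 3 / 10 * max 0 (min 1 (4 * t)) + 1 / 2 * max 0 (min 1 (4 * t - 2)),
    3 / 2 + 1 / 2 * max 0 (min 1 (4 * t)) + max 0 (min 1 (4 * t - 2)),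
    1 - max 0 (min 1 (4 * t - 1)) + max 0 (min 1 (4 * t - 3)))

/-- The edge of the drawing that joins `inl a` and `inr b`. -/
def edgePath (a b : Fin 3) : ℝ → ℝ × ℝ × ℝ :=
  if a = 0 ∧ b = 0 then handlePath else topPath (vertexPosition (.inl a)) (vertexPosition (.inr b))

theorem handlePath_cases {t : ℝ} (h0 : 0 ≤ t) (h1 : t ≤ 1) :
    (t ≤ 1 / 4 ∧ handlePath t = (7 / 10 + 6 / 5 * t, 3 / 2 + 2 * t, 1)) ∨
    ((1 / 4 ≤ t ∧ t ≤ 1 / 2) ∧ handlePath t = (1, 2, 2 - 4 * t)) ∨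
    ((1 / 2 ≤ t ∧ t ≤ 3 / 4) ∧ handlePath t = (2 * t, 4 * t, 0)) ∨
    (3 / 4 ≤ t ∧ handlePath t = (3 / 2, 3, 4 * t - 3)) := by
  have low : ∀ u : ℝ, u ≤ 0 → max 0 (min 1 u) = 0 := fun u hu =>
    max_eq_left ((min_le_right _ _).trans hu)
  have mid : ∀ u : ℝ, 0 ≤ u → u ≤ 1 → max 0 (min 1 u) = u := fun u hu hu' => by
    rw [min_eq_right hu', max_eq_right hu]
  have high : ∀ u : ℝ, 1 ≤ u → max 0 (min 1 u) = 1 := fun u hu => by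
    rw [min_eq_left hu, max_eq_right zero_le_one]
  rcases le_total t (1 / 4) with h | h
  · refine .inl ⟨h, ?_⟩
    rw [handlePath, mid (4 * t) (by linarith) (by linarith), low (4 * t - 1) (by linarith),
      low (4 * t - 2) (by linarith), low (4 * t - 3) (by linarith)]
    refine Prod.ext ?_ (Prod.ext ?_ ?_) <;> simp only <;> ring
  rcases le_total t (1 / 2) with h' | h'
  · refine .inr (.inl ⟨⟨h, h'⟩, ?_⟩)
    rw [handlePath, high (4 * t) (by linarith), mid (4 * t - 1) (by linarith) (by linarith),
      low (4 * t - 2) (by linarith), low (4 * t - 3) (by linarith)]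
    refine Prod.ext ?_ (Prod.ext ?_ ?_) <;> simp only <;> ring
  rcases le_total t (3 / 4) with h'' | h''
  · refine .inr (.inr (.inl ⟨⟨h', h''⟩, ?_⟩))
    rw [handlePath, high (4 * t) (by linarith), high (4 * t - 1) (by linarith),
      mid (4 * t - 2) (by linarith) (by linarith), low (4 * t - 3) (by linarith)]
    refine Prod.ext ?_ (Prod.ext ?_ ?_) <;> simp only <;> ring
  · refine .inr (.inr (.inr ⟨h'', ?_⟩))
    rw [handlePath, high (4 * t) (by linarith), high (4 * t - 1) (by linarith),
      high (4 * t - 2) (by linarith), mid (4 * t - 3) (by linarith) (by linarith)]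
    refine Prod.ext ?_ (Prod.ext ?_ ?_) <;> simp only <;> ring

theorem continuous_edgePath (a b : Fin 3) : Continuous (edgePath a b) := by
  unfold edgePath
  split_ifs
  · unfold handlePath
    fun_prop
  · unfold topPath
    fun_prop

theorem edgePath_zero (a b : Fin 3) :
    edgePath a b 0 =
      ((vertexPosition (.inl a)).1, (vertexPosition (.inl a)).2, 1) := by
  unfold edgePath
  split_ifs with h
  · obtain ⟨rfl, rfl⟩ := h
    norm_num [handlePath, vertexPosition]
  · simp [topPath]

theorem edgePath_one (a b : Fin 3) :
    edgePath a b 1 =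
      ((vertexPosition (.inr b)).1, (vertexPosition (.inr b)).2, 1) := by
  unfold edgePath
  split_ifs with h
  · obtain ⟨rfl, rfl⟩ := h
    norm_num [handlePath, vertexPosition]
  · simp [topPath]

theorem edgePath_fst_mem (a b : Fin 3) {t : ℝ} (h0 : 0 ≤ t) (h1 : t ≤ 1) :
    3 / 5 ≤ (edgePath a b t).1 ∧ (edgePath a b t).1 ≤ 12 / 5 := by
  unfold edgePath
  split_ifs with h
  · rcases handlePath_cases h0 h1 with ⟨h, e⟩ | ⟨h, e⟩ | ⟨h, e⟩ | ⟨h, e⟩ <;> rw [e] <;>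
      constructor <;> simp only <;> linarith
  · fin_cases a <;> fin_cases b <;> simp [topPath, vertexPosition] <;> constructor <;> linarith

theorem edgePath_mem_orientableSurface {g i : ℕ} (hi : i < g) (a b : Fin 3) {t : ℝ} (h0 : 0 ≤ t)
    (h1 : t ≤ 1) : tunnelShift i (edgePath a b t) ∈ orientableSurface g := by
  have hx := edgePath_fst_mem a b h0 h1
  by_cases h : a = 0 ∧ b = 0
  · rw [edgePath, if_pos h] at hx ⊢
    rcases handlePath_cases h0 h1 with ⟨h, e⟩ | ⟨h, e⟩ | ⟨h, e⟩ | ⟨h, e⟩ <;> rw [e] at hx ⊢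
    · exact top_mem_orientableSurface hi hx (by constructor <;> linarith)
        fun h' => by linarith [h'.1.1]
    · exact tunnelEdge_mem_orientableSurface hi (by constructor <;> linarith)
    · exact bottom_mem_orientableSurface hi hx (by constructor <;> linarith)
        fun h' => by linarith [h'.2.2]
    · exact side_mem_orientableSurface hi hx (by constructor <;> linarith)
  · rw [edgePath, if_neg h] at hx ⊢
    refine top_mem_orientableSurface hi hx ?_ ?_ <;> fin_cases a <;> fin_cases b <;>
      simp [vertexPosition] at h ⊢
    all_goals first
      | (constructor <;> linarith)
      | (intros; linarith)

theorem edgePath_injOn (a b : Fin 3) : Set.InjOn (edgePath a b) (Set.Icc 0 1) := by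
  rintro t ⟨h0, h1⟩ t' ⟨h0', h1'⟩ h
  by_cases hab : a = 0 ∧ b = 0
  · rw [edgePath, if_pos hab] at h
    rcases handlePath_cases h0 h1 with ⟨hr, e⟩ | ⟨hr, e⟩ | ⟨hr, e⟩ | ⟨hr, e⟩ <;>
      rcases handlePath_cases h0' h1' with ⟨hr', e'⟩ | ⟨hr', e'⟩ | ⟨hr', e'⟩ | ⟨hr', e'⟩ <;>
      rw [e, e', Prod.mk.injEq, Prod.mk.injEq] at h <;> obtain ⟨hx, hy, hz⟩ := h <;> linarith
  · rw [edgePath, if_neg hab] at h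
    simp only [topPath, Prod.mk.injEq] at h
    obtain ⟨hx, hy, -⟩ := h
    fin_cases a <;> fin_cases b <;> simp [vertexPosition] at hab hx hy <;> linarith

/-- The straight edges do not cross. For each pair of edges, equality of the two points is a pair of
linear equations in the parameters `t` and `t'`, which has no solution in the given range. -/
theorem topPath_ne_topPath {a b a' b' : Fin 3} (h : ¬ (a = 0 ∧ b = 0)) (h' : ¬ (a' = 0 ∧ b' = 0))
    (hne : ¬ (a = a' ∧ b = b')) {t t' : ℝ} (h0 : 0 < t) (h1 : t < 1) (h0' : 0 ≤ t') (h1' : t' ≤ 1) :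
    topPath (vertexPosition (.inl a)) (vertexPosition (.inr b)) t ≠
      topPath (vertexPosition (.inl a')) (vertexPosition (.inr b')) t' := by
  intro heq
  simp only [topPath, Prod.mk.injEq] at heq
  obtain ⟨hx, hy, -⟩ := heq
  fin_cases a <;> fin_cases b <;> simp [vertexPosition] at h hx hy <;>
    fin_cases a' <;> fin_cases b' <;> simp at h' hne hx hy <;> linarith

/-- The path through the tunnel meets the straight edges in at most a common end. -/
theorem handlePath_eq_topPath {a b : Fin 3} (h : ¬ (a = 0 ∧ b = 0)) {t t' : ℝ}
    (h0 : 0 ≤ t) (h1 : t ≤ 1) (h0' : 0 ≤ t') (h1' : t' ≤ 1)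
    (heq : handlePath t = topPath (vertexPosition (.inl a)) (vertexPosition (.inr b)) t') :
    (t = 0 ∨ t = 1) ∧ (t' = 0 ∨ t' = 1) := by
  simp only [topPath] at heq
  rcases handlePath_cases h0 h1 with ⟨hr, e⟩ | ⟨hr, e⟩ | ⟨hr, e⟩ | ⟨hr, e⟩ <;>
    rw [e, Prod.mk.injEq, Prod.mk.injEq] at heq <;> obtain ⟨hx, hy, hz⟩ := heq
  · fin_cases a <;> fin_cases b <;> simp [vertexPosition] at h hx hy <;>
      exact ⟨.inl (by linarith), .inl (by linarith)⟩
  · fin_cases a <;> fin_cases b <;> simp [vertexPosition] at h hx hy <;> exfalso <;> linarith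
  · norm_num at hz
  · fin_cases a <;> fin_cases b <;> simp [vertexPosition] at h hx hy <;>
      exact ⟨.inr (by linarith), .inr (by linarith)⟩

theorem edgePath_ne_edgePath {a b a' b' : Fin 3} (hne : ¬ (a = a' ∧ b = b')) {t t' : ℝ}
    (h0 : 0 < t) (h1 : t < 1) (h0' : 0 ≤ t') (h1' : t' ≤ 1) :
    edgePath a b t ≠ edgePath a' b' t' := by
  unfold edgePath
  split_ifs with h h' h'
  · exact absurd ⟨h.1.trans h'.1.symm, h.2.trans h'.2.symm⟩ hne
  · intro heq
    rcases (handlePath_eq_topPath h' h0.le h1.le h0' h1' heq).1 with rfl | rfl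
    · exact h0.false
    · exact h1.false
  · intro heq
    rcases (handlePath_eq_topPath h h0' h1' h0.le h1.le heq.symm).2 with rfl | rfl
    · exact h0.false
    · exact h1.false
  · exact topPath_ne_topPath h h' hne h0 h1 h0' h1'

/-- Every vertex is an end of an edge other than a given one. -/
theorem exists_edgePath_eq_vertexPosition (v : Fin 3 ⊕ Fin 3) (a b : Fin 3) :
    ∃ a' b' : Fin 3, ∃ t : ℝ, ¬ (a = a' ∧ b = b') ∧ 0 ≤ t ∧ t ≤ 1 ∧
      edgePath a' b' t = ((vertexPosition v).1, (vertexPosition v).2, 1) := by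
  rcases v with c | c
  · exact ⟨c, b + 1, 0, by simp, le_rfl, zero_le_one, edgePath_zero _ _⟩
  · exact ⟨a + 1, c, 1, by simp, zero_le_one, le_rfl, edgePath_one _ _⟩

theorem vertexPosition_injective : Function.Injective vertexPosition := by
  rintro (a | a) (b | b) h <;> fin_cases a <;> fin_cases b <;>
    first
      | rfl
      | (exfalso; norm_num [vertexPosition] at h)

/-! ### The embedding of the disjoint copies -/

theorem exists_eq_of_mem_edgeSet {g : ℕ}
    (e : ((completeBipartiteGraph (Fin 3) (Fin 3)).disjointCopies g).edgeSet) :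
    ∃ x : Fin g × Fin 3 × Fin 3, (e : Sym2 (Fin g × (Fin 3 ⊕ Fin 3))) =
      s((x.1, .inl x.2.1), (x.1, .inr x.2.2)) := by
  obtain ⟨e, he⟩ := e
  induction e using Sym2.ind with
  | _ u v =>
    obtain ⟨i, u⟩ := u
    obtain ⟨j, v⟩ := v
    obtain ⟨hij, h⟩ := (mem_edgeSet _).mp he
    simp only at hij
    subst hij
    rcases u with a | b <;> rcases v with a' | b' <;> simp at h
    · exact ⟨(i, a, b'), rfl⟩
    · exact ⟨(i, a', b), Sym2.eq_swap⟩

/-- The drawing of `g` disjoint copies of `K₃,₃` on the surface with `g` handles, one copy around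
each tunnel. -/
def copiesEmbedding (g : ℕ) : SpaceEmbedding
    ((completeBipartiteGraph (Fin 3) (Fin 3)).disjointCopies g) (orientableSurface g) :=
  let ends : ((completeBipartiteGraph (Fin 3) (Fin 3)).disjointCopies g).edgeSet →
      Fin g × Fin 3 × Fin 3 := fun e => (exists_eq_of_mem_edgeSet e).choose
  have hends : ∀ e : ((completeBipartiteGraph (Fin 3) (Fin 3)).disjointCopies g).edgeSet,
      (e : Sym2 (Fin g × (Fin 3 ⊕ Fin 3))) =
      s(((ends e).1, .inl (ends e).2.1), ((ends e).1, .inr (ends e).2.2)) :=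
    fun e => (exists_eq_of_mem_edgeSet e).choose_spec
  let pos : Fin 3 ⊕ Fin 3 → ℝ × ℝ × ℝ := fun v => ((vertexPosition v).1, (vertexPosition v).2, 1)
  have hpos : ∀ (i : Fin g) v, tunnelShift i (pos v) ∈ orientableSurface g := fun i v => by
    obtain ⟨a, b, t, -, h0, h1, h⟩ := exists_edgePath_eq_vertexPosition v 0 0
    rw [← show edgePath a b t = pos v from h]
    exact edgePath_mem_orientableSurface i.2 a b h0 h1
  have hposx : ∀ v, 3 / 5 ≤ (pos v).1 ∧ (pos v).1 ≤ 12 / 5 := fun v => by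
    obtain ⟨a, b, t, -, h0, h1, h⟩ := exists_edgePath_eq_vertexPosition v 0 0
    rw [← show edgePath a b t = pos v from h]
    exact edgePath_fst_mem a b h0 h1
  { point := fun v => ⟨tunnelShift v.1 (pos v.2), hpos v.1 v.2⟩
    arc := fun e =>
      { toFun := fun t => ⟨tunnelShift (ends e).1 (edgePath (ends e).2.1 (ends e).2.2 t),
          edgePath_mem_orientableSurface (ends e).1.2 _ _ t.2.1 t.2.2⟩
        continuous_toFun := ((continuous_tunnelShift _).comp
          ((continuous_edgePath _ _).comp continuous_subtype_val)).subtype_mk _ }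
    point_injective := by
      rintro ⟨i, u⟩ ⟨j, v⟩ h
      obtain ⟨hij, huv⟩ := tunnelShift_inj (hposx u) (hposx v) (congrArg Subtype.val h)
      simp only [pos, Prod.mk.injEq, and_true] at huv
      exact Prod.ext (Fin.ext hij) (vertexPosition_injective (Prod.ext huv.1 huv.2))
    arc_injective := by
      intro e t t' h
      obtain ⟨-, h'⟩ := tunnelShift_inj (edgePath_fst_mem _ _ t.2.1 t.2.2)
        (edgePath_fst_mem _ _ t'.2.1 t'.2.2) (congrArg Subtype.val h)
      exact Subtype.ext (edgePath_injOn _ _ t.2 t'.2 h')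
    arc_ends := by
      intro e
      rw [hends e, Sym2.map_mk]
      exact congrArg₂ (fun p q => s(p, q))
        (Subtype.ext (congrArg (tunnelShift _) (edgePath_zero _ _)))
        (Subtype.ext (congrArg (tunnelShift _) (edgePath_one _ _)))
    arc_ne_point := by
      intro e t ht v h
      obtain ⟨a, b, t', hne, h0, h1, h'⟩ :=
        exists_edgePath_eq_vertexPosition v.2 (ends e).2.1 (ends e).2.2
      obtain ⟨-, h''⟩ := tunnelShift_inj (edgePath_fst_mem _ _ t.2.1 t.2.2) (hposx v.2)
        (congrArg Subtype.val h)
      exact edgePath_ne_edgePath hne ht.1 ht.2 h0 h1 (h''.trans h'.symm)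
    arc_ne_arc := by
      intro e e' hne t ht t' h
      obtain ⟨hij, h'⟩ := tunnelShift_inj (edgePath_fst_mem _ _ t.2.1 t.2.2)
        (edgePath_fst_mem _ _ t'.2.1 t'.2.2) (congrArg Subtype.val h)
      refine edgePath_ne_edgePath (fun hab => hne (Subtype.ext ?_)) ht.1 ht.2 t'.2.1 t'.2.2 h'
      rw [hends e, hends e', Fin.ext hij, hab.1, hab.2] }

theorem orientableGenus_disjointCopies_le (g : ℕ) :
    ((completeBipartiteGraph (Fin 3) (Fin 3)).disjointCopies g).orientableGenus ≤ (g : ℕ∞) :=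
  sInf_le ⟨g, rfl, ⟨copiesEmbedding g⟩⟩

end SimpleGraph

end

theorem theorem1 (g : ℕ) (hg : 1 ≤ g) :
    ((8 / 3 : ℝ≥0∞) ^ g ≤ (SimpleGraph.maxPfaffianNumber g : ℝ≥0∞)) ∧
    (((completeBipartiteGraph (Fin 3) (Fin 3)).disjointCopies g).orientableGenus ≤ (g : ℕ∞) ∧
      (8 / 3 : ℝ) ^ g ≤
        (((completeBipartiteGraph (Fin 3) (Fin 3)).disjointCopies g).pfaffianNumber : ℝ)) := by
  have hgenus := SimpleGraph.orientableGenus_disjointCopies_le g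
  have hpf := SimpleGraph.pow_le_pfaffianNumber g
  refine ⟨?_, hgenus, hpf⟩
  have hle : ((((completeBipartiteGraph (Fin 3) (Fin 3)).disjointCopies g).pfaffianNumber : ℕ) :
      ℕ∞) ≤ SimpleGraph.maxPfaffianNumber g :=
    le_sSup ⟨_, inferInstance, _, hgenus, rfl⟩
  refine le_trans ?_ (ENat.toENNReal_le.mpr hle)
  have h := ENNReal.ofReal_le_ofReal hpf
  rw [ENNReal.ofReal_natCast, ENNReal.ofReal_pow (by norm_num),
    ENNReal.ofReal_div_of_pos (by norm_num)] at h
  simpa using h
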